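/- Let $\mathbb{F}$ be an infinite field of arbitrary characteristic, and let $\mathbb{F}\langle X\rangle$ be the free unital associative $\mathbb{F}$-algebra on the countable set of letters $X=\{x_1,x_2,\dots\}$. Let $\mathsf{A}_1=\mathbb{F}\langle x,y\rangle/\langle yx-xy-1\rangle$ be the Weyl algebra and let $\mathsf{V}\subset \mathsf{A}_1$ be the $\mathbb{F}$-linear span of $x$ and $y$. A weak polynomial identity for the pair $(\mathsf{A}_1,\mathsf{V})$ is an element $f=f(x_1,\dots,x_m)\in\mathbb{F}\langle X\rangle$ such that $f(a_1,\dots,a_m)=0$ in $\mathsf{A}_1$ for all $a_1,\dots,a_m\in \mathsf{V}$. Writing $[a,b]=ab-ba$, put $$\Gamma_3(x_1,x_2,x_3)=[[x_1,x_2],x_3],\qquad \mathrm{St}_3(x_1,x_2,x_3)=x_1[x_2,x_3]-x_2[x_1,x_3]+x_3[x_1,x_2],$$ $$T_4(x_1,x_2,x_3,x_4)=[x_1,x_2][x_3,x_4]-[x_1,x_3][x_2,x_4]+[x_2,x_3][x_1,x_4].$$ Let $\mathcal{I}$ be the L-ideal of $\mathbb{F}\langle X\rangle$ generated by $\Gamma_3$,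 $\mathrm{St}_3$ and $T_4$, that is, the $\mathbb{F}$-linear span of all elements $u\,h(g_1,\dots,g_m)\,v$ with $h\in\{\Gamma_3,\mathrm{St}_3,T_4\}$ (and $m=3$, $3$, $4$ respectively), $u,v\in\mathbb{F}\langle X\rangle$, and $g_1,\dots,g_m$ linear combinations of letters. Then every weak polynomial identity $f$ for $(\mathsf{A}_1,\mathsf{V})$ of (total) degree $4$ (not necessarily homogeneous) lies in $\mathcal{I}$. -/

import Mathlib

namespace WeakPI

noncomputable section

/-- The free unital associative algebra `F⟨X⟩` on the countable set of letters
`X = {x 0, x 1, x 2, …}`. -/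
abbrev FreeAlg (F : Type*) [Field F] := FreeAlgebra F ℕ

/-- The letters of `F⟨X⟩`. -/
def x (F : Type*) [Field F] (i : ℕ) : FreeAlg F := FreeAlgebra.ι F i

/-- The (total) degree of a noncommutative polynomial: the largest length of a monomial that
occurs in it with nonzero coefficient (and `0` for the zero polynomial). -/
def degree {F : Type*} [Field F] (f : FreeAlg F) : ℕ :=
  (FreeAlgebra.equivMonoidAlgebraFreeMonoid f : MonoidAlgebra F (FreeMonoid ℕ)).coeff.support.sup
    FreeMonoid.length

/-- Substitution `f(a 0, a 1, …)` of elements of an algebra for the letters. -/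
def subst {F : Type*} [Field F] {A : Type*} [Ring A] [Algebra F A] (a : ℕ → A) (f : FreeAlg F) :
    A :=
  FreeAlgebra.lift F a f

/-- `f` is a polynomial identity for the subspace `V` of the algebra `A`: it vanishes under all
substitutions of elements of `V`. When `V` generates `A`, these are the weak polynomial identities
for the pair `(A, V)`. -/
def IsWeakIdentity {F : Type*} [Field F] {A : Type*} [Ring A] [Algebra F A] (V : Submodule F A)
    (f : FreeAlg F) : Prop :=
  ∀ a : ℕ → A, (∀ i, a i ∈ V) → subst a f = 0

/-- The defining relation `y x = x y + 1` of the Weyl algebra, where `x` and `y` are the free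
generators with index `0` and `1`. -/
inductive WeylRel (F : Type*) [Field F] : FreeAlgebra F (Fin 2) → FreeAlgebra F (Fin 2) → Prop
  | yx : WeylRel F (FreeAlgebra.ι F 1 * FreeAlgebra.ι F 0)
      (FreeAlgebra.ι F 0 * FreeAlgebra.ι F 1 + 1)

/-- The Weyl algebra `A₁ = F⟨x, y⟩ / ⟨y x - x y - 1⟩`. -/
abbrev WeylAlgebra (F : Type*) [Field F] := RingQuot (WeylRel F)

/-- The generator `x` of the Weyl algebra. -/
def weylX (F : Type*) [Field F] : WeylAlgebra F :=
  RingQuot.mkAlgHom F (WeylRel F) (FreeAlgebra.ι F 0)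

/-- The generator `y` of the Weyl algebra. -/
def weylY (F : Type*) [Field F] : WeylAlgebra F :=
  RingQuot.mkAlgHom F (WeylRel F) (FreeAlgebra.ι F 1)

/-- The subspace `V = span {x, y}` of the Weyl algebra. -/
def weylV (F : Type*) [Field F] : Submodule F (WeylAlgebra F) :=
  Submodule.span F {weylX F, weylY F}

/-- The L-ideal of `F⟨X⟩` generated by a set `S`: the linear span of all `u * f(g 0, g 1, …) * v`
with `f ∈ S`, `u, v ∈ F⟨X⟩` and `g 0, g 1, …` linear combinations of letters. -/
def lIdeal {F : Type*} [Field F] (S : Set (FreeAlg F)) : Submodule F (FreeAlg F) :=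
  Submodule.span F {h | ∃ f ∈ S, ∃ g : ℕ → FreeAlg F,
    (∀ i, g i ∈ Submodule.span F (Set.range (x F))) ∧ ∃ u v : FreeAlg F, h = u * subst g f * v}

/-- `Γ₃(x₁, x₂, x₃) = [[x₁, x₂], x₃]`, where `⁅a, b⁆ = a * b - b * a`. -/
def Gamma3 (F : Type*) [Field F] : FreeAlg F := ⁅⁅x F 1, x F 2⁆, x F 3⁆

/-- `St₃(x₁, x₂, x₃) = x₁ [x₂, x₃] - x₂ [x₁, x₃] + x₃ [x₁, x₂]`. -/
def St3 (F : Type*) [Field F] : FreeAlg F :=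
  x F 1 * ⁅x F 2, x F 3⁆ - x F 2 * ⁅x F 1, x F 3⁆ + x F 3 * ⁅x F 1, x F 2⁆

/-- `T₄(x₁, x₂, x₃, x₄) = [x₁, x₂][x₃, x₄] - [x₁, x₃][x₂, x₄] + [x₂, x₃][x₁, x₄]`. -/
def T4 (F : Type*) [Field F] : FreeAlg F :=
  ⁅x F 1, x F 2⁆ * ⁅x F 3, x F 4⁆ - ⁅x F 1, x F 3⁆ * ⁅x F 2, x F 4⁆
    + ⁅x F 2, x F 3⁆ * ⁅x F 1, x F 4⁆

end

end WeakPI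

namespace WeakPI
open Polynomial

variable {F : Type*} [Field F]

/-! Send x_i to a_i t + b_i d/dt with indeterminate a_i, b_i, apply the result to 1 and put t = 1.
This linear map, `symbol`, kills weak identities because F is infinite, and it factors through
F⟨X⟩/I. It remains to see that it is injective on the image of degree ≤ 4; faithfulness of the Weyl
action, false in characteristic p, is never needed. Modulo I commutators of letters are central
(Γ₃), St₃ moves the smallest letter into a commutator, and T₄ is the Plücker relation. So the
quotient has three layers: words, a commutator times a word, products of two commutators. In each
layer a map φ reads a standard product off coordinate monomials, and q - φ(symbol q) lies in the
next layer for every spanning q. Hence a kernel element drops through all layers to 0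
(`mem_commWords`, `mem_commComms`, `eq_zero_of_mem_commComms`). -/

/-- Polynomials in the coordinates `a i`, `b i` of generic elements `a i • x + b i • y`. -/
abbrev CoordRing (F : Type*) [Field F] := MvPolynomial (ℕ ⊕ ℕ) F

/-! ### The three identities for a Weyl pair over commuting scalars -/

section WeylPair

variable {R E : Type*} [CommRing R] [Ring E] [Algebra R E] {T D : E}

theorem lie_of_weyl (h : D * T = T * D + 1) (p q p' q' : R) :
    ⁅p • T + q • D, p' • T + q' • D⁆ = algebraMap R E (p' * q - p * q') := by
  rw [Ring.lie_def, Algebra.algebraMap_eq_smul_one]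
  simp only [add_mul, mul_add, smul_mul_smul_comm, h]
  module

/-- Commutators are the 2×2 minors of the coordinate matrix. Γ₃ vanishes since these are scalars,
St₃ expands 3×3 determinants with a repeated row, and T₄ is the Plücker relation. -/
theorem subst_eq_zero_of_weyl [Algebra F E] (h : D * T = T * D + 1) {f : FreeAlg F}
    (hf : f ∈ ({Gamma3 F, St3 F, T4 F} : Set (FreeAlg F))) (g : ℕ → E)
    (hg : ∀ i, ∃ p q : R, g i = p • T + q • D) : subst g f = 0 := by
  choose p q hg using hg
  have hl (i j : ℕ) : ⁅g i, g j⁆ = algebraMap R E (p j * q i - p i * q j) := by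
    rw [hg, hg, lie_of_weyl h]
  have hx (i : ℕ) : FreeAlgebra.lift F g (x F i) = g i := by simp [x]
  have hxl (i j : ℕ) : FreeAlgebra.lift F g ⁅x F i, x F j⁆
      = algebraMap R E (p j * q i - p i * q j) := by
    rw [← hl, Ring.lie_def, Ring.lie_def, map_sub, map_mul, map_mul, hx, hx]
  rcases hf with rfl | rfl | rfl
  · rw [subst, Gamma3, Ring.lie_def, map_sub, map_mul, map_mul, hxl, hx, Algebra.commutes, sub_self]
  · have hc (i : ℕ) (r : R) : g i * algebraMap R E r = r • g i := by
      rw [← Algebra.commutes, Algebra.smul_def]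
    simp only [subst, St3, map_add (FreeAlgebra.lift F g), map_sub (FreeAlgebra.lift F g),
      map_mul (FreeAlgebra.lift F g), hxl, hx, hc]
    simp only [hg]
    module
  · rw [subst, T4]
    simp only [map_add (FreeAlgebra.lift F g), map_sub (FreeAlgebra.lift F g),
      map_mul (FreeAlgebra.lift F g), hxl]
    simp only [← map_mul, ← map_add, ← map_sub]
    rw [← map_zero (algebraMap R E)]
    congr 1
    ring

end WeylPair

/-! ### The generic substitution and its symbol -/

section Generic

/-- Multiplication by the variable on `R[t]`. -/
noncomputable def mulT (R : Type*) [CommRing R] : Module.End R R[X] := LinearMap.mulLeft R X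

/-- Differentiation on `R[t]`. -/
noncomputable def derivT (R : Type*) [CommRing R] : Module.End R R[X] := Polynomial.derivative

theorem derivT_mul_mulT (R : Type*) [CommRing R] :
    derivT R * mulT R = mulT R * derivT R + 1 := by
  refine LinearMap.ext fun p => ?_
  simp [mulT, derivT, add_comm]

/-- The generic substitution `x i ↦ a i t + b i d/dt`. -/
noncomputable def genericRep (F : Type*) [Field F] :
    FreeAlg F →ₐ[F] Module.End (CoordRing F) (CoordRing F)[X] :=
  FreeAlgebra.lift F fun i =>
    (MvPolynomial.X (Sum.inl i) : CoordRing F) • mulT (CoordRing F)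
      + (MvPolynomial.X (Sum.inr i) : CoordRing F) • derivT (CoordRing F)

/-- The action of a noncommutative polynomial on `1` under the generic substitution,
evaluated at `t = 1`. -/
noncomputable def symbol (F : Type*) [Field F] : FreeAlg F →ₗ[F] CoordRing F :=
  ((Polynomial.leval (1 : CoordRing F)).restrictScalars F) ∘ₗ
    ((LinearMap.applyₗ (R := CoordRing F) (1 : (CoordRing F)[X])).restrictScalars F) ∘ₗ
      (genericRep F).toLinearMap

theorem symbol_apply (f : FreeAlg F) : symbol F f = (genericRep F f 1).eval 1 := rfl

theorem genericRep_x (i : ℕ) (p : (CoordRing F)[X]) :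
    genericRep F (x F i) p = (MvPolynomial.X (Sum.inl i) : CoordRing F) • (X * p)
      + (MvPolynomial.X (Sum.inr i) : CoordRing F) • derivative p := by
  simp [genericRep, x, mulT, derivT]

theorem genericRep_lIdeal {f : FreeAlg F}
    (hf : f ∈ lIdeal {Gamma3 F, St3 F, T4 F}) : genericRep F f = 0 := by
  induction hf using Submodule.span_induction with
  | zero => simp
  | add f g _ _ hf hg => simp [hf, hg]
  | smul c f _ hf => simp [hf]
  | mem f hf =>
    obtain ⟨h, hh, g, hg, u, v, rfl⟩ := hf
    have key : genericRep F (subst g h) = subst (fun i => genericRep F (g i)) h := by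
      rw [subst, subst, ← AlgHom.comp_apply]
      congr 1
      ext i
      simp
    rw [map_mul, map_mul, key, subst_eq_zero_of_weyl (R := CoordRing F) (derivT_mul_mulT (CoordRing F))
      hh _ ?_, mul_zero, zero_mul]
    intro i
    have hgi := hg i
    generalize g i = y at hgi ⊢
    induction hgi using Submodule.span_induction with
    | mem y hy =>
      obtain ⟨j, rfl⟩ := hy
      exact ⟨MvPolynomial.X (Sum.inl j), MvPolynomial.X (Sum.inr j), by simp [genericRep, x]⟩
    | zero => exact ⟨0, 0, by simp⟩
    | add y z _ _ hy hz =>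
      obtain ⟨p, q, h1⟩ := hy
      obtain ⟨p', q', h2⟩ := hz
      exact ⟨p + p', q + q', by rw [map_add, h1, h2]; module⟩
    | smul c y _ hy =>
      obtain ⟨p, q, h1⟩ := hy
      exact ⟨c • p, c • q, by rw [map_smul, h1, smul_add, smul_assoc, smul_assoc]⟩

/-- Specializing the coordinates commutes with the action; this links the generic substitution to
actual substitutions from V. -/
theorem genericRep_map (e : ℕ ⊕ ℕ → F) (f : FreeAlg F) (p : (CoordRing F)[X]) :
    (genericRep F f p).map (MvPolynomial.eval e)
      = FreeAlgebra.lift F (fun i => e (Sum.inl i) • mulT F + e (Sum.inr i) • derivT F) f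
          (p.map (MvPolynomial.eval e)) := by
  induction f using FreeAlgebra.induction generalizing p with
  | grade0 r =>
    simp [Module.algebraMap_end_apply, Algebra.smul_def]
  | grade1 i =>
    rw [← x, genericRep_x]
    simp [mulT, derivT, x, Polynomial.smul_eq_C_mul, Polynomial.derivative_map]
  | mul f g hf hg => simp [hf, hg]
  | add f g hf hg => simp [hf, hg]

theorem symbol_eq_zero_of_isWeakIdentity [Infinite F] {f : FreeAlg F}
    (hf : IsWeakIdentity (weylV F) f) : symbol F f = 0 := by
  refine MvPolynomial.funext fun e => ?_
  -- The action of A₁ on F[t], with x acting as t and y as d/dt.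
  let ρ : WeylAlgebra F →ₐ[F] Module.End F F[X] := RingQuot.liftAlgHom F
    ⟨FreeAlgebra.lift F ![mulT F, derivT F], by
      rintro _ _ ⟨⟩
      simp [derivT_mul_mulT]⟩
  have hρx : ρ (weylX F) = mulT F := by simp [ρ, weylX]
  have hρy : ρ (weylY F) = derivT F := by simp [ρ, weylY]
  have h0 := hf (fun i => e (Sum.inl i) • weylX F + e (Sum.inr i) • weylY F) fun i =>
    Submodule.mem_span_pair.2 ⟨_, _, rfl⟩
  have h1 : FreeAlgebra.lift F
      (fun i => e (Sum.inl i) • mulT F + e (Sum.inr i) • derivT F) f = 0 := by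
    rw [← map_zero ρ, ← h0, subst, ← AlgHom.comp_apply]
    congr 1
    ext i
    simp [hρx, hρy]
  have h2 := genericRep_map e f 1
  rw [h1, LinearMap.zero_apply] at h2
  have h3 := congrArg (Polynomial.eval (MvPolynomial.eval e 1)) h2
  rw [Polynomial.eval_map_apply] at h3
  rw [symbol_apply, h3]
  simp

end Generic

/-! ### Symbols of words and commutators -/

section Symbol

/-- The word `x i₁ ⋯ x iₙ` of a list of indices. -/
noncomputable def word (F : Type*) [Field F] (l : List ℕ) : FreeAlg F := (l.map (x F)).prod

@[simp] theorem word_nil : word F [] = 1 := rfl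

@[simp] theorem word_cons (i : ℕ) (l : List ℕ) : word F (i :: l) = x F i * word F l := by
  simp [word]

theorem mem_span_word {f : FreeAlg F} {n : ℕ} (hf : degree f ≤ n) :
    f ∈ Submodule.span F {w | ∃ l : List ℕ, l.length ≤ n ∧ w = word F l} := by
  set e := FreeAlgebra.equivMonoidAlgebraFreeMonoid (R := F) (X := ℕ)
  have he : f = ∑ w ∈ (e f).coeff.support, (e f).coeff w • word F w.toList := by
    apply e.injective
    rw [map_sum]
    conv_lhs => rw [← MonoidAlgebra.sum_coeff_single (e f)]
    refine Finset.sum_congr rfl fun w _ => ?_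
    have h (w : FreeMonoid ℕ) : e (word F w.toList) = MonoidAlgebra.of F _ w := by
      induction w using FreeMonoid.inductionOn' with
      | one => simp [MonoidAlgebra.one_def]
      | of_mul i w ih =>
        rw [FreeMonoid.toList_of_mul, word_cons, map_mul, ih]
        simp [e, x, FreeAlgebra.equivMonoidAlgebraFreeMonoid]
    rw [map_smul, h]
    simp
  rw [he]
  refine Submodule.sum_mem _ fun w hw => Submodule.smul_mem _ _ (Submodule.subset_span
    ⟨w.toList, ?_, rfl⟩)
  exact (Finset.le_sup (f := FreeMonoid.length) hw).trans hf

/-- The monomial in the coordinates with the given `a`-indices and `b`-indices. -/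
noncomputable def coordMonomial (F : Type*) [Field F] (A B : List ℕ) : CoordRing F :=
  (A.map fun i => MvPolynomial.X (Sum.inl i)).prod * (B.map fun i => MvPolynomial.X (Sum.inr i)).prod

/-- A commutator of letters acts as a scalar, so it factors out of the symbol. -/
theorem symbol_lie_mul (i j : ℕ) (f : FreeAlg F) :
    symbol F (⁅x F i, x F j⁆ * f)
      = (coordMonomial F [j] [i] - coordMonomial F [i] [j]) * symbol F f := by
  have h : genericRep F ⁅x F i, x F j⁆ = algebraMap (CoordRing F) _
      (coordMonomial F [j] [i] - coordMonomial F [i] [j]) := by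
    have h := lie_of_weyl (R := CoordRing F) (derivT_mul_mulT (CoordRing F))
      (MvPolynomial.X (Sum.inl i)) (MvPolynomial.X (Sum.inr i))
      (MvPolynomial.X (Sum.inl j)) (MvPolynomial.X (Sum.inr j))
    rw [Ring.lie_def] at h
    rw [Ring.lie_def, map_sub, map_mul, map_mul]
    simpa [genericRep, x, coordMonomial] using h
  simp [symbol_apply, h, Module.algebraMap_end_apply, sub_mul]

/-- The specialization `b i = 0`. -/
noncomputable def killB (F : Type*) [Field F] : CoordRing F →ₐ[F] CoordRing F :=
  MvPolynomial.aeval (Sum.elim (fun i => MvPolynomial.X (Sum.inl i)) 0)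

/-- With every b_i = 0 only multiplications by t remain, so the symbol records exactly the multiset
of letters. -/
theorem killB_symbol_word (l : List ℕ) :
    killB F (symbol F (word F l)) = coordMonomial F l [] := by
  have key : (genericRep F (word F l) 1).map (killB F : CoordRing F →+* CoordRing F)
      = C (coordMonomial F l []) * X ^ l.length := by
    induction l with
    | nil => simp [coordMonomial]
    | cons i l ih =>
      rw [word_cons, map_mul, Module.End.mul_apply, genericRep_x, Polynomial.map_add,
        Polynomial.smul_eq_C_mul, Polynomial.smul_eq_C_mul, Polynomial.map_mul, Polynomial.map_mul,
        Polynomial.map_mul, ih]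
      simp [killB, coordMonomial]
      ring
  have h := congrArg (Polynomial.eval ((killB F : CoordRing F →+* CoordRing F) 1)) key
  have h2 := Polynomial.eval_map_apply (p := genericRep F (word F l) 1)
    (killB F : CoordRing F →+* CoordRing F) 1
  rw [symbol_apply]
  simpa using h2.symm.trans h

theorem symbol_word_nil : symbol F (word F []) = coordMonomial F [] [] := by
  simp [symbol_apply, coordMonomial]

theorem symbol_word_one (i : ℕ) : symbol F (word F [i]) = coordMonomial F [i] [] := by
  simp [symbol_apply, coordMonomial, genericRep_x]

theorem symbol_word_two (i j : ℕ) : symbol F (word F [i, j])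
    = coordMonomial F [i, j] [] + coordMonomial F [j] [i] := by
  simp [symbol_apply, coordMonomial, genericRep_x, Polynomial.smul_eq_C_mul]
  ring

end Symbol

/-! ### Linear maps defined on coordinate monomials -/

section Standard

variable {Q : Type*} [AddCommGroup Q] [Module F Q]

/-- The linear map sending a coordinate monomial to the value of `g` on its sorted lists of
`a`-indices and `b`-indices. -/
noncomputable def onMonomials (g : List ℕ → List ℕ → Q) : CoordRing F →ₗ[F] Q :=
  (MvPolynomial.basisMonomials (ℕ ⊕ ℕ) F).constr F fun s =>
    g ((s.toMultiset.filterMap Sum.getLeft?).sort (· ≤ ·))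
      ((s.toMultiset.filterMap Sum.getRight?).sort (· ≤ ·))

theorem coordMonomial_eq (A B : List ℕ) : coordMonomial F A B = MvPolynomial.monomial
    (Multiset.toFinsupp ((A.map Sum.inl ++ B.map Sum.inr : List (ℕ ⊕ ℕ)) : Multiset (ℕ ⊕ ℕ))) 1 := by
  have h (l : List (ℕ ⊕ ℕ)) : MvPolynomial.monomial (Multiset.toFinsupp (l : Multiset (ℕ ⊕ ℕ))) 1
      = (l.map MvPolynomial.X : List (CoordRing F)).prod := by
    induction l with
    | nil => simp
    | cons i l ih =>
      rw [List.map_cons, List.prod_cons, ← ih, MvPolynomial.X, MvPolynomial.monomial_mul, one_mul,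
        ← Multiset.toFinsupp_singleton, ← map_add]
      rfl
  rw [h, coordMonomial, List.map_append, List.prod_append, List.map_map, List.map_map]
  rfl

theorem onMonomials_coordMonomial (g : List ℕ → List ℕ → Q) (A B : List ℕ) :
    onMonomials g (coordMonomial F A B)
      = g ((A : Multiset ℕ).sort (· ≤ ·)) ((B : Multiset ℕ).sort (· ≤ ·)) := by
  rw [coordMonomial_eq, onMonomials,
    ← show MvPolynomial.basisMonomials (ℕ ⊕ ℕ) F _ = _ from
      congrFun (MvPolynomial.coe_basisMonomials _ _) _, Module.Basis.constr_basis,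
    Multiset.toFinsupp_toMultiset, Multiset.filterMap_coe, Multiset.filterMap_coe]
  have h1 : List.filterMap Sum.getLeft? (A.map Sum.inl ++ B.map (Sum.inr : ℕ → ℕ ⊕ ℕ)) = A := by
    simp [List.filterMap_append, List.filterMap_map, Function.comp_def]
  have h2 : List.filterMap Sum.getRight? (A.map (Sum.inl : ℕ → ℕ ⊕ ℕ) ++ B.map Sum.inr) = B := by
    simp [List.filterMap_append, List.filterMap_map, Function.comp_def]
  rw [h1, h2]

end Standard

/-! ### Relations in F⟨X⟩/I -/

section Quotient

/-- The L-ideal generated by `Γ₃`, `St₃` and `T₄`, as an ideal. -/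
noncomputable def relIdeal (F : Type*) [Field F] : Ideal (FreeAlg F) where
  __ := (lIdeal {Gamma3 F, St3 F, T4 F}).toAddSubmonoid
  smul_mem' r f hf := by
    change f ∈ lIdeal _ at hf
    change r * f ∈ lIdeal _
    induction hf using Submodule.span_induction with
    | zero => simp
    | add f g _ _ hf hg => rw [mul_add]; exact add_mem hf hg
    | smul c f _ hf => rw [mul_smul_comm]; exact Submodule.smul_mem _ _ hf
    | mem f hf =>
      obtain ⟨h, hh, g, hg, u, v, rfl⟩ := hf
      exact Submodule.subset_span ⟨h, hh, g, hg, r * u, v, by simp only [mul_assoc]⟩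

theorem mem_relIdeal {f : FreeAlg F} :
    f ∈ relIdeal F ↔ f ∈ lIdeal {Gamma3 F, St3 F, T4 F} := Iff.rfl

instance : (relIdeal F).IsTwoSided where
  mul_mem_of_left {f} r hf := by
    rw [mem_relIdeal] at hf ⊢
    induction hf using Submodule.span_induction with
    | zero => simp
    | add f g _ _ hf hg => rw [add_mul]; exact add_mem hf hg
    | smul c f _ hf => rw [smul_mul_assoc]; exact Submodule.smul_mem _ _ hf
    | mem f hf =>
      obtain ⟨h, hh, g, hg, u, v, rfl⟩ := hf
      exact Submodule.subset_span ⟨h, hh, g, hg, u, v * r, by simp only [mul_assoc]⟩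

/-- The relatively free algebra `F⟨X⟩ / I`. -/
abbrev RelFree (F : Type*) [Field F] := FreeAlg F ⧸ relIdeal F

/-- The image of a letter in `F⟨X⟩ / I`. -/
noncomputable def letter (F : Type*) [Field F] (i : ℕ) : RelFree F :=
  Ideal.Quotient.mkₐ F (relIdeal F) (x F i)

/-- The commutator of two letters in `F⟨X⟩ / I`. -/
noncomputable def comm (F : Type*) [Field F] (i j : ℕ) : RelFree F :=
  letter F i * letter F j - letter F j * letter F i

/-- The image of a word in `F⟨X⟩ / I`. -/
noncomputable def relWord (F : Type*) [Field F] (l : List ℕ) : RelFree F :=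
  (l.map (letter F)).prod

theorem mk_word (l : List ℕ) : Ideal.Quotient.mkₐ F (relIdeal F) (word F l) = relWord F l := by
  rw [word, map_list_prod, List.map_map]; rfl

theorem mk_lie (i j : ℕ) : Ideal.Quotient.mkₐ F (relIdeal F) ⁅x F i, x F j⁆ = comm F i j := by
  rw [Ring.lie_def, map_sub, map_mul, map_mul]; rfl

theorem mk_subst {h : FreeAlg F} (hh : h ∈ ({Gamma3 F, St3 F, T4 F} : Set (FreeAlg F)))
    (n : ℕ → ℕ) : Ideal.Quotient.mkₐ F (relIdeal F) (subst (fun i => x F (n i)) h) = 0 := by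
  refine Ideal.Quotient.eq_zero_iff_mem.2 (Submodule.subset_span
    ⟨h, hh, fun i => x F (n i), fun i => Submodule.subset_span ⟨_, rfl⟩, 1, 1, ?_⟩)
  simp

theorem subst_lie (n : ℕ → ℕ) (i j : ℕ) :
    FreeAlgebra.lift F (fun i => x F (n i)) ⁅x F i, x F j⁆ = ⁅x F (n i), x F (n j)⁆ := by
  simp [Ring.lie_def, x]

theorem comm_mul_letter (i j k : ℕ) : comm F i j * letter F k = letter F k * comm F i j := by
  -- Letters are numbered from 1, so entry 0 of the list is padding.
  have h := mk_subst (F := F) (h := Gamma3 F) (by simp) fun t => [0, i, j, k].getD t 0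
  rw [subst, Gamma3, Ring.lie_def, map_sub, map_mul, map_mul, subst_lie, map_sub, map_mul, map_mul,
    mk_lie] at h
  exact sub_eq_zero.1 (by simpa [x, letter] using h)

theorem letter_mul_comm (i j k : ℕ) :
    letter F i * comm F j k = letter F j * comm F i k - letter F k * comm F i j := by
  have h := mk_subst (F := F) (h := St3 F) (by simp) fun t => [0, i, j, k].getD t 0
  simp only [subst, St3, map_add, map_sub, map_mul, subst_lie, mk_lie] at h
  have h' : letter F i * comm F j k - letter F j * comm F i k + letter F k * comm F i j = 0 := by
    simpa [x, letter] using h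
  rw [← sub_eq_zero, ← h']
  abel

theorem comm_mul_comm_plucker (i j k l : ℕ) :
    comm F i j * comm F k l = comm F i k * comm F j l - comm F j k * comm F i l := by
  have h := mk_subst (F := F) (h := T4 F) (by simp) fun t => [0, i, j, k, l].getD t 0
  simp only [subst, T4, map_add, map_sub, map_mul, subst_lie, mk_lie] at h
  have h' : comm F i j * comm F k l - comm F i k * comm F j l + comm F j k * comm F i l = 0 := by
    simpa using h
  rw [← sub_eq_zero, ← h']
  abel

@[simp] theorem comm_self (i : ℕ) : comm F i i = 0 := sub_self _

theorem comm_swap (i j : ℕ) : comm F i j = -comm F j i := (neg_sub _ _).symm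

theorem comm_mul_comm (i j k l : ℕ) : comm F i j * comm F k l = comm F k l * comm F i j := by
  rw [comm.eq_1 F k l, mul_sub, sub_mul, ← mul_assoc, ← mul_assoc, comm_mul_letter, comm_mul_letter,
    mul_assoc, mul_assoc, comm_mul_letter, comm_mul_letter, mul_assoc, mul_assoc]

/-- Each adjacent swap costs a commutator, which is central and can be moved to the front. -/
theorem relWord_sub_relWord_mem {l l' : List ℕ} (h : l.Perm l') :
    relWord F l - relWord F l' ∈ Submodule.span F
      {u | ∃ i j m, m.length + 2 = l.length ∧ u = comm F i j * relWord F m} := by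
  induction h with
  | nil => simp
  | @cons i l l' _ ih =>
    have h : relWord F (i :: l) - relWord F (i :: l')
        = LinearMap.mulLeft F (letter F i) (relWord F l - relWord F l') := by
      simp [relWord, mul_sub]
    rw [h]
    refine Submodule.span_induction (fun u hu => ?_) (by simp)
      (fun u v _ _ hu hv => by rw [map_add]; exact add_mem hu hv)
      (fun c u _ hu => by rw [map_smul]; exact Submodule.smul_mem _ _ hu) ih
    obtain ⟨j, k, m, hm, rfl⟩ := hu
    refine Submodule.subset_span ⟨j, k, i :: m, by simp [← hm], ?_⟩
    simp [relWord, ← mul_assoc, comm_mul_letter]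
  | swap i j l =>
    refine Submodule.subset_span ⟨j, i, l, by simp, ?_⟩
    simp [relWord, comm, sub_mul, mul_assoc]
  | @trans l l' l'' h _ ih ih' =>
    rw [← h.length_eq] at ih'
    rw [← sub_add_sub_cancel _ (relWord F l')]
    exact add_mem ih ih'

/-- The map induced by `symbol` on `F⟨X⟩ / I`. -/
noncomputable def relSymbol (F : Type*) [Field F] : RelFree F →ₗ[F] CoordRing F :=
  ((Polynomial.leval (1 : CoordRing F)).restrictScalars F) ∘ₗ
    ((LinearMap.applyₗ (R := CoordRing F) (1 : Polynomial (CoordRing F))).restrictScalars F) ∘ₗ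
      (Ideal.Quotient.liftₐ (relIdeal F) (genericRep F) fun _ hf =>
        genericRep_lIdeal (mem_relIdeal.1 hf)).toLinearMap

theorem relSymbol_mk (f : FreeAlg F) :
    relSymbol F (Ideal.Quotient.mkₐ F (relIdeal F) f) = symbol F f := rfl

theorem relSymbol_relWord (l : List ℕ) : relSymbol F (relWord F l) = symbol F (word F l) := by
  rw [← mk_word, relSymbol_mk]

theorem relSymbol_comm_mul (i j : ℕ) (q : RelFree F) : relSymbol F (comm F i j * q)
    = (coordMonomial F [j] [i] - coordMonomial F [i] [j]) * relSymbol F q := by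
  obtain ⟨f, rfl⟩ := Ideal.Quotient.mkₐ_surjective F (relIdeal F) q
  rw [← mk_lie, ← map_mul, relSymbol_mk, relSymbol_mk, symbol_lie_mul]

theorem coordMonomial_mul (A B A' B' : List ℕ) :
    coordMonomial F A B * coordMonomial F A' B' = coordMonomial F (A ++ A') (B ++ B') := by
  simp only [coordMonomial, List.map_append, List.prod_append]
  ring

end Quotient

/-! ### Descent through the three layers -/

section Straightening

/-- Combinations of products of a commutator and a word of length at most `2`. -/
noncomputable def commWords (F : Type*) [Field F] : Submodule F (RelFree F) :=
  Submodule.span F {u | ∃ i j m, m.length ≤ 2 ∧ u = comm F i j * relWord F m}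

/-- Combinations of products of two commutators. -/
noncomputable def commComms (F : Type*) [Field F] : Submodule F (RelFree F) :=
  Submodule.span F {u | ∃ i j k l, u = comm F i j * comm F k l}

/-- Here φ is a left inverse of the symbol modulo U, checked on a spanning set; no linear
independence is needed. -/
theorem mem_of_relSymbol_eq_zero {S : Set (RelFree F)} {U : Submodule F (RelFree F)}
    (φ : CoordRing F →ₗ[F] RelFree F) (h : ∀ q ∈ S, q - φ (relSymbol F q) ∈ U) {q : RelFree F}
    (hq : q ∈ Submodule.span F S) (h0 : relSymbol F q = 0) : q ∈ U := by
  have hle : Submodule.span F S ≤ U.comap (LinearMap.id - φ ∘ₗ relSymbol F) :=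
    Submodule.span_le.2 h
  simpa [h0] using hle hq

theorem mem_commWords {q : RelFree F}
    (hq : q ∈ Submodule.span F {w | ∃ l : List ℕ, l.length ≤ 4 ∧ w = relWord F l})
    (h0 : relSymbol F q = 0) : q ∈ commWords F := by
  refine mem_of_relSymbol_eq_zero
    (onMonomials (fun A _ => relWord F A) ∘ₗ (killB F).toLinearMap) ?_ hq h0
  rintro _ ⟨l, hl, rfl⟩
  rw [LinearMap.comp_apply, relSymbol_relWord, AlgHom.toLinearMap_apply, killB_symbol_word,
    onMonomials_coordMonomial]
  refine Submodule.span_mono ?_ (relWord_sub_relWord_mem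
    (Multiset.coe_eq_coe.1 (Multiset.sort_eq (l : Multiset ℕ) (· ≤ ·))).symm)
  rintro _ ⟨i, j, m, hm, rfl⟩
  exact ⟨i, j, m, by omega, rfl⟩

theorem sort_one (i : ℕ) : ((([i] : List ℕ) : Multiset ℕ).sort (· ≤ ·)) = [i] :=
  Multiset.sort_singleton _ _

theorem sort_coe_of_pairwise {l l' : List ℕ} (hp : l.Perm l') (h : l'.Pairwise (· ≤ ·)) :
    (l : Multiset ℕ).sort (· ≤ ·) = l' := by
  rw [Multiset.coe_eq_coe.2 hp, Multiset.coe_sort, List.mergeSort_eq_self _ h]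

theorem sort_pair (i j : ℕ) : (([i, j] : List ℕ) : Multiset ℕ).sort (· ≤ ·)
    = if i ≤ j then [i, j] else [j, i] := by
  split_ifs with h
  · exact sort_coe_of_pairwise (.refl _) (by simpa)
  · exact sort_coe_of_pairwise (.swap _ _ _) (by simp; omega)

/-- The standard product with `a`-indices `A` and `b`-indices `B`, for `B` of length `1`. -/
noncomputable def stdOne (F : Type*) [Field F] : List ℕ → List ℕ → RelFree F
  | i :: A, [j] => if i ≤ j then -(comm F i j * relWord F A) else 0
  | _, _ => 0

/-- The standard product with `a`-indices `A` and `b`-indices `B`, both of length `2`. -/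
noncomputable def stdTwo (F : Type*) [Field F] : List ℕ → List ℕ → RelFree F
  | [i, j], [k, l] => if i ≤ k ∧ j ≤ l then comm F i k * comm F j l else 0
  | _, _ => 0

theorem onMonomials_stdTwo (i j k l : ℕ) (hij : i ≤ j) (hkl : k ≤ l) :
    onMonomials (stdTwo F) (coordMonomial F [i, j] [k, l])
      = if i ≤ k ∧ j ≤ l then comm F i k * comm F j l else 0 := by
  rw [onMonomials_coordMonomial, sort_pair, sort_pair, if_pos hij, if_pos hkl, stdTwo]

theorem coordMonomial_swap_left (i j : ℕ) (B : List ℕ) :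
    coordMonomial F [i, j] B = coordMonomial F [j, i] B := by
  simp [coordMonomial, mul_comm (MvPolynomial.X (Sum.inl i))]

theorem coordMonomial_swap_right (i j : ℕ) (A : List ℕ) :
    coordMonomial F A [i, j] = coordMonomial F A [j, i] := by
  simp [coordMonomial, mul_comm (MvPolynomial.X (Sum.inr i))]

theorem relSymbol_comm_mul_comm (i j k l : ℕ) : relSymbol F (comm F i j * comm F k l)
    = coordMonomial F [j, l] [i, k] - coordMonomial F [j, k] [i, l]
      - coordMonomial F [i, l] [j, k] + coordMonomial F [i, k] [j, l] := by
  have h : comm F k l = comm F k l * relWord F [] := by simp [relWord]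
  rw [h, relSymbol_comm_mul, relSymbol_comm_mul, relSymbol_relWord, symbol_word_nil]
  simp only [coordMonomial_mul, mul_sub, sub_mul, List.cons_append, List.nil_append]
  abel

/-- As i is the least index, the two monomials containing b_i contribute 0. The other two give the
product itself when j ≤ l, and its Plücker expansion otherwise. -/
theorem onMonomials_comm_mul_comm_of_le {i j k l : ℕ} (hij : i ≤ j) (hkl : k ≤ l) (hik : i ≤ k) :
    onMonomials (stdTwo F) (relSymbol F (comm F i j * comm F k l)) = comm F i j * comm F k l := by
  have h1 : onMonomials (stdTwo F) (coordMonomial F [j, l] [i, k]) = 0 := by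
    rcases le_total j l with h | h
    · rw [onMonomials_stdTwo _ _ _ _ h hik]; grind [comm_self]
    · rw [coordMonomial_swap_left, onMonomials_stdTwo _ _ _ _ h hik, ite_eq_right_iff]
      intro hh
      rw [show l = i by omega, comm_self, zero_mul]
  have h2 : onMonomials (stdTwo F) (coordMonomial F [j, k] [i, l]) = 0 := by
    rcases le_total j k with h | h
    · rw [onMonomials_stdTwo _ _ _ _ h (hik.trans hkl)]; grind [comm_self]
    · rw [coordMonomial_swap_left, onMonomials_stdTwo _ _ _ _ h (hik.trans hkl)]
      grind [comm_self]
  have h3 : onMonomials (stdTwo F) (coordMonomial F [i, l] [j, k])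
      = if l ≤ j then comm F i k * comm F l j else 0 := by
    rcases le_total j k with h | h
    · rw [onMonomials_stdTwo _ _ _ _ (hik.trans hkl) h]; grind [comm_self]
    · rw [coordMonomial_swap_right, onMonomials_stdTwo _ _ _ _ (hik.trans hkl) h]
      grind [comm_self]
  have h4 : onMonomials (stdTwo F) (coordMonomial F [i, k] [j, l])
      = if j ≤ l then comm F i j * comm F k l else comm F i l * comm F k j := by
    rcases le_total j l with h | h
    · rw [onMonomials_stdTwo _ _ _ _ hik h]; grind [comm_self]
    · rw [coordMonomial_swap_right, onMonomials_stdTwo _ _ _ _ hik h]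
      grind [comm_self]
  rw [relSymbol_comm_mul_comm]
  simp only [map_add, map_sub, h1, h2, h3, h4]
  rcases lt_trichotomy j l with h | rfl | h
  · simp [h.le, h.not_ge]
  · simp
  · rw [if_pos h.le, if_neg h.not_ge, comm_mul_comm_plucker i j k l, comm_swap j l, comm_swap j k,
      comm_mul_comm i l]
    noncomm_ring

theorem onMonomials_comm_mul_comm (i j k l : ℕ) :
    onMonomials (stdTwo F) (relSymbol F (comm F i j * comm F k l)) = comm F i j * comm F k l := by
  wlog hij : i ≤ j generalizing i j
  · rw [comm_swap, neg_mul, map_neg, map_neg, this _ _ (le_of_not_ge hij)]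
  wlog hkl : k ≤ l generalizing k l
  · rw [comm_swap k, mul_neg, map_neg, map_neg, this _ _ (le_of_not_ge hkl)]
  rcases le_total i k with hik | hki
  · exact onMonomials_comm_mul_comm_of_le hij hkl hik
  · rw [comm_mul_comm, onMonomials_comm_mul_comm_of_le hkl hij hki]

theorem coordMonomial_perm {A A' : List ℕ} (h : A.Perm A') (B : List ℕ) :
    coordMonomial F A B = coordMonomial F A' B := by
  rw [coordMonomial, coordMonomial, (h.map _).prod_eq]

theorem onMonomials_stdOne_of_length_ne {A B : List ℕ} (h : B.length ≠ 1) :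
    onMonomials (stdOne F) (coordMonomial F A B) = 0 := by
  have hB : ((B : Multiset ℕ).sort (· ≤ ·)).length ≠ 1 := by simpa
  rw [onMonomials_coordMonomial]
  unfold stdOne
  split <;> simp_all

theorem onMonomials_stdOne {A A' : List ℕ} {i j : ℕ} (h : A.Perm (i :: A'))
    (hA : A'.Pairwise (· ≤ ·)) (hi : ∀ k ∈ A', i ≤ k) :
    onMonomials (stdOne F) (coordMonomial F A [j])
      = if i ≤ j then -(comm F i j * relWord F A') else 0 := by
  rw [onMonomials_coordMonomial, sort_one,
    sort_coe_of_pairwise h (List.pairwise_cons.2 ⟨hi, hA⟩), stdOne]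

/-- The least a-index is at least j, so the standard product is 0 or contains [x_j, x_j]. -/
theorem onMonomials_stdOne_eq_zero {A : List ℕ} {j : ℕ} (hA : ∀ k ∈ A, j ≤ k) :
    onMonomials (stdOne F) (coordMonomial F A [j]) = 0 := by
  rw [onMonomials_coordMonomial, sort_one]
  cases h : (A : Multiset ℕ).sort (· ≤ ·) with
  | nil => rfl
  | cons i A' =>
    have hi : i ∈ A := by
      rw [← Multiset.mem_coe, ← Multiset.mem_sort (· ≤ ·), h]
      exact List.mem_cons_self
    rw [stdOne]
    split_ifs with hij
    · rw [le_antisymm hij (hA i hi), comm_self, zero_mul, neg_zero]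
    · rfl

theorem onMonomials_comm_mul (i j : ℕ) {m : List ℕ} (hm : m.length ≤ 2) :
    onMonomials (stdOne F) (relSymbol F (comm F i j * relWord F m))
      = onMonomials (stdOne F) (coordMonomial F (j :: m) [i])
        - onMonomials (stdOne F) (coordMonomial F (i :: m) [j]) := by
  rw [relSymbol_comm_mul, relSymbol_relWord]
  match m, hm with
  | [], _ => rw [symbol_word_nil]; simp [coordMonomial_mul, sub_mul]
  | [k], _ => rw [symbol_word_one]; simp [coordMonomial_mul, sub_mul]
  | [k, l], _ =>
    rw [symbol_word_two]
    -- The term a_l b_k of the symbol of x_k x_l yields b-degree 2, which `stdOne` discards.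
    simp [coordMonomial_mul, sub_mul, mul_add, onMonomials_stdOne_of_length_ne]

theorem comm_mul_relWord_sub_mem {l l' : List ℕ} (i j : ℕ) (h : l.Perm l') (hl : l.length ≤ 2) :
    comm F i j * relWord F l - comm F i j * relWord F l' ∈ commComms F := by
  rw [← mul_sub, ← LinearMap.mulLeft_apply F]
  have h := Submodule.mem_map_of_mem (f := LinearMap.mulLeft F (comm F i j))
    (relWord_sub_relWord_mem (F := F) h)
  rw [Submodule.map_span] at h
  refine Submodule.span_mono ?_ h
  rintro _ ⟨_, ⟨p, q, m, hm, rfl⟩, rfl⟩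
  obtain rfl : m = [] := List.eq_nil_of_length_eq_zero (by omega)
  exact ⟨i, j, p, q, by simp [relWord]⟩

/-- St₃ exchanges x_k with the letters of the commutator; used with k minimal, it straightens the
product. -/
theorem comm_mul_relWord_cons (i j k : ℕ) (l : List ℕ) : comm F i j * relWord F (k :: l)
    = comm F k j * relWord F (i :: l) - comm F k i * relWord F (j :: l) := by
  simp only [relWord, List.map_cons, List.prod_cons, ← mul_assoc, comm_mul_letter]
  rw [letter_mul_comm k, sub_mul]

theorem comm_mul_relWord_sub_onMonomials_mem {i j : ℕ} {m : List ℕ} (hij : i ≤ j)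
    (hs : m.Pairwise (· ≤ ·)) (hm : m.length ≤ 2) :
    comm F i j * relWord F m - onMonomials (stdOne F) (relSymbol F (comm F i j * relWord F m))
      ∈ commComms F := by
  rw [onMonomials_comm_mul i j hm]
  by_cases hi : ∀ k ∈ m, i ≤ k
  · rw [onMonomials_stdOne_eq_zero (by simpa [hij]), onMonomials_stdOne (.refl _) hs hi, if_pos hij]
    simp
  · cases m with
    | nil => simp at hi
    | cons k l =>
      have hk := List.pairwise_cons.1 hs
      have hki : k ≤ i := by
        by_contra! h
        exact hi fun t ht => (List.mem_cons.1 ht).elim (fun e => e ▸ h.le)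
          fun e => h.le.trans (hk.1 t e)
      -- With k least, [x_k, x_q] x_p l is standard once p :: l is sorted, and sorting costs only
      -- products of two commutators.
      have key (p q : ℕ) (hp : k ≤ p) (hq : k ≤ q) :
          comm F k q * relWord F (p :: l) + onMonomials (stdOne F) (coordMonomial F (p :: k :: l) [q])
            ∈ commComms F := by
        have hsort : (p :: l).Perm (((p :: l : List ℕ) : Multiset ℕ).sort (· ≤ ·)) :=
          (Multiset.coe_eq_coe.1 (Multiset.sort_eq _ _)).symm
        rw [onMonomials_stdOne ((List.Perm.swap _ _ _).trans (hsort.cons k))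
          (Multiset.pairwise_sort _ _) ?_, if_pos hq, ← sub_eq_add_neg]
        · exact comm_mul_relWord_sub_mem k q hsort (by simpa using hm)
        · intro t ht
          rcases List.mem_cons.1 (hsort.mem_iff.2 ht) with rfl | ht
          · exact hp
          · exact hk.1 t ht
      rw [comm_mul_relWord_cons]
      convert sub_mem (key i j hki (hki.trans hij)) (key j i (hki.trans hij) hki) using 1
      abel

theorem mem_commComms {q : RelFree F} (hq : q ∈ commWords F) (h0 : relSymbol F q = 0) :
    q ∈ commComms F := by
  refine mem_of_relSymbol_eq_zero (onMonomials (stdOne F)) ?_ hq h0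
  rintro _ ⟨i, j, m, hm, rfl⟩
  wlog hij : i ≤ j generalizing i j
  · rw [comm_swap, neg_mul, map_neg, map_neg, ← neg_sub']
    exact neg_mem (this j i (le_of_not_ge hij))
  have hsort : m.Perm ((m : Multiset ℕ).sort (· ≤ ·)) :=
    (Multiset.coe_eq_coe.1 (Multiset.sort_eq _ _)).symm
  have h := add_mem (comm_mul_relWord_sub_mem (F := F) i j hsort hm)
    (comm_mul_relWord_sub_onMonomials_mem hij (Multiset.pairwise_sort _ _) (hsort.length_eq ▸ hm))
  convert h using 1
  rw [onMonomials_comm_mul i j hm, onMonomials_comm_mul i j (hsort.length_eq ▸ hm),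
    coordMonomial_perm (hsort.cons j), coordMonomial_perm (hsort.cons i)]
  abel

theorem eq_zero_of_mem_commComms {q : RelFree F} (hq : q ∈ commComms F)
    (h0 : relSymbol F q = 0) : q = 0 := by
  refine (Submodule.mem_bot F).1 (mem_of_relSymbol_eq_zero (onMonomials (stdTwo F)) ?_ hq h0)
  rintro _ ⟨i, j, k, l, rfl⟩
  rw [onMonomials_comm_mul_comm, sub_self]
  exact zero_mem _

theorem mem_lIdeal_of_isWeakIdentity [Infinite F] {f : FreeAlg F}
    (hf : IsWeakIdentity (weylV F) f) (hdeg : degree f ≤ 4) :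
    f ∈ lIdeal {Gamma3 F, St3 F, T4 F} := by
  rw [← mem_relIdeal]
  refine Ideal.Quotient.eq_zero_iff_mem.1 ?_
  change Ideal.Quotient.mkₐ F (relIdeal F) f = 0
  have h0 : relSymbol F (Ideal.Quotient.mkₐ F (relIdeal F) f) = 0 := by
    rw [relSymbol_mk, symbol_eq_zero_of_isWeakIdentity hf]
  refine eq_zero_of_mem_commComms (mem_commComms (mem_commWords ?_ h0) h0) h0
  have h := Submodule.mem_map_of_mem (f := (Ideal.Quotient.mkₐ F (relIdeal F)).toLinearMap)
    (mem_span_word hdeg)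
  rw [Submodule.map_span] at h
  refine Submodule.span_mono ?_ h
  rintro _ ⟨_, ⟨l, hl, rfl⟩, rfl⟩
  exact ⟨l, hl, mk_word l⟩

end Straightening

end WeakPI

theorem mainTheorem3 (F : Type*) [Field F] [Infinite F] (f : WeakPI.FreeAlg F)
    (hf : WeakPI.IsWeakIdentity (WeakPI.weylV F) f) (hdeg : WeakPI.degree f = 4) :
    f ∈ WeakPI.lIdeal {WeakPI.Gamma3 F, WeakPI.St3 F, WeakPI.T4 F} :=
  WeakPI.mem_lIdeal_of_isWeakIdentity hf hdeg.le
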